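/- Write $\langle w_1\cdots w_n|=v_{w_1}^*\otimes\cdots\otimes v_{w_n}^*$ ($w_i\in\{0,1\}$) for the standard basis of $((\mathbb{C}^2)^*)^{\otimes n}$, and for $I\subseteq[n]=\{1,\dots,n\}$ let $\langle I|$ be the basis covector of the indicator word of $I$. Let $\mathrm{SWAP}=\langle 0000|+\langle 1010|+\langle 0101|+\langle 1111|$ and $G=\mathrm{SWAP}\otimes\mathrm{SWAP}\in((\mathbb{C}^2)^*)^{\otimes 8}$. The groups $\mathrm{SL}(2,\mathbb{C})^8\subset\mathrm{GL}(2,\mathbb{C})^8$ act on $((\mathbb{C}^2)^*)^{\otimes 8}$ factorwise by $g.\varphi=\varphi\circ g^{-1}$, and $\overline{\,\cdot\,}$ denotes Zariski closure. Let $P_{W_8}$ be the linear projector of $((\mathbb{C}^2)^*)^{\otimes 8}$ onto the subspace $W_8$ spanned by the $\langle I|$ with $|I|$ even, along the span of the $\langle I|$ with $|I|$ odd. Let $$\mathcal{P}^\vee_8=\Big\{\sum_{I\subseteq[8]}\operatorname{Pf}(M_I)\,\langle [8]\setminus I|\;:\;M\in\mathbb{C}^{8\times 8},\ M^T=-M\Big\}$$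 be the variety of elementary Pfaffian cogates of arity $8$, where $M_I$ is the principal submatrix of $M$ on $I$ and $\operatorname{Pf}(M_\emptyset)=1$. Let $\mathbb{C}^*\mathcal{P}^\vee_8=\{cP: c\in\mathbb{C}\setminus\{0\},\ P\in\mathcal{P}^\vee_8\}$, and let $\mathbb{C}\mathcal{P}^\vee_8$ be the (closed) cone over $\mathcal{P}^\vee_8$, i.e. the Zariski closure of $\{cP: c\in\mathbb{C},\ P\in\mathcal{P}^\vee_8\}$. Then $$P_{W_8}\big(\overline{\mathrm{SL}(2,\mathbb{C})^8.G}\big)\cap\big(\mathbb{C}\mathcal{P}^\vee_8\setminus\{0\}\big)=\emptyset \qquad\text{and}\qquad P_{W_8}\big(\mathrm{GL}(2,\mathbb{C})^8.G\big)\cap\mathbb{C}^*\mathcal{P}^\vee_8=\emptyset .$$ -/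

import Mathlib

noncomputable section

namespace PfaffianCogate

/-- Tensors in `((ℂ²)^*)^{⊗ n}`, in coordinates: `T w` is the coefficient of `T` on the basis
covector `⟨w₁ ⋯ wₙ| = v_{w₁}^* ⊗ ⋯ ⊗ v_{wₙ}^*`, where `w ∈ {0,1}ⁿ`. -/
abbrev Cotensor (n : ℕ) : Type := (Fin n → Fin 2) → ℂ

/-- The basis covector `⟨w₁ ⋯ wₙ|`. -/
def braWord {n : ℕ} (w : Fin n → Fin 2) : Cotensor n := Pi.single w 1

/-- The indicator word `χ_I` of a subset `I` of `[n]`. -/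
def indicatorWord {n : ℕ} (I : Finset (Fin n)) : Fin n → Fin 2 := fun k => if k ∈ I then 1 else 0

/-- The basis covector `⟨I| = ⟨χ_I(1) ⋯ χ_I(n)|`. -/
def bra {n : ℕ} (I : Finset (Fin n)) : Cotensor n := braWord (indicatorWord I)

/-- The tensor product of cotensors (concatenation of words on basis covectors). -/
def tensor {m n : ℕ} (S : Cotensor m) (T : Cotensor n) : Cotensor (m + n) :=
  fun w => S (fun i => w (Fin.castAdd n i)) * T (fun j => w (Fin.natAdd m j))

/-- The SWAP gate as a cotensor: `⟨0000| + ⟨1010| + ⟨0101| + ⟨1111|`. -/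
def SWAP : Cotensor 4 :=
  braWord ![0, 0, 0, 0] + braWord ![1, 0, 1, 0] + braWord ![0, 1, 0, 1] + braWord ![1, 1, 1, 1]

/-- The Pfaffian of a skew-symmetric matrix, by expansion along the first row. It is `1` for the
empty matrix and `0` in odd size. -/
def pfaffian : (n : ℕ) → Matrix (Fin n) (Fin n) ℂ → ℂ
  | 0, _ => 1
  | 1, _ => 0
  | n + 2, A => ∑ j : Fin (n + 1), (-1) ^ (j : ℕ) * A 0 j.succ *
      pfaffian n (A.submatrix (fun k => (j.succAbove k).succ) (fun k => (j.succAbove k).succ))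

/-- The principal submatrix `M_I`, rows and columns in increasing order. -/
def principal {n : ℕ} (M : Matrix (Fin n) (Fin n) ℂ) (I : Finset (Fin n)) :
    Matrix (Fin I.card) (Fin I.card) ℂ :=
  M.submatrix (I.orderEmbOfFin rfl) (I.orderEmbOfFin rfl)

/-- `sPf^∨(M) = ∑_{I ⊆ [n]} Pf(M_I) ⟨[n] \ I|`. -/
def sPfDual {n : ℕ} (M : Matrix (Fin n) (Fin n) ℂ) : Cotensor n :=
  ∑ I : Finset (Fin n), pfaffian I.card (principal M I) • bra Iᶜ

/-- The variety `𝒫^∨_n` of elementary Pfaffian cogates of arity `n`: the image of `sPf^∨` on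
skew-symmetric matrices. -/
def cogateVariety (n : ℕ) : Set (Cotensor n) :=
  {T | ∃ M : Matrix (Fin n) (Fin n) ℂ, M.transpose = -M ∧ T = sPfDual M}

/-- The Zariski closure of a set of cotensors: the common zeros of all polynomials in the
coordinates that vanish on the set. -/
def zariskiClosure {n : ℕ} (S : Set (Cotensor n)) : Set (Cotensor n) :=
  MvPolynomial.zeroLocus ℂ (MvPolynomial.vanishingIdeal ℂ S)

/-- The punctured cone `ℂ^* 𝒫^∨_n` of nonzero scalar multiples of elementary cogates. -/
def puncturedCone (n : ℕ) : Set (Cotensor n) :=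
  {T | ∃ c : ℂ, c ≠ 0 ∧ ∃ P ∈ cogateVariety n, T = c • P}

/-- The (closed) cone `ℂ 𝒫^∨_n` over the variety of elementary cogates: the Zariski closure of the
set of all scalar multiples of elementary cogates. -/
def cone (n : ℕ) : Set (Cotensor n) :=
  zariskiClosure {T | ∃ c : ℂ, ∃ P ∈ cogateVariety n, T = c • P}

/-- The action of `GL(2,ℂ)ⁿ` on `((ℂ²)^*)^{⊗ n}` induced by `g.φ = φ ∘ g⁻¹` on each factor. -/
def act {n : ℕ} (g : Fin n → Matrix.GeneralLinearGroup (Fin 2) ℂ) (T : Cotensor n) : Cotensor n :=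
  fun w => ∑ u : Fin n → Fin 2,
    T u * ∏ k, ((g k)⁻¹ : Matrix.GeneralLinearGroup (Fin 2) ℂ).val (u k) (w k)

/-- On elementary tensors `φ₁ ⊗ ⋯ ⊗ φₙ` the action is `φₖ ↦ φₖ gₖ⁻¹` (row vectors). -/
theorem act_elementary {n : ℕ} (g : Fin n → Matrix.GeneralLinearGroup (Fin 2) ℂ)
    (φ : Fin n → Fin 2 → ℂ) :
    act g (fun w => ∏ k, φ k (w k)) =
      fun w => ∏ k, Matrix.vecMul (φ k)
        ((g k)⁻¹ : Matrix.GeneralLinearGroup (Fin 2) ℂ).val (w k) := by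
  funext w
  simp only [act, Matrix.vecMul, dotProduct, Finset.prod_univ_sum, Fintype.piFinset_univ,
    ← Finset.prod_mul_distrib]

/-- The `GL(2,ℂ)ⁿ`-orbit of a cotensor. -/
def glOrbit {n : ℕ} (T : Cotensor n) : Set (Cotensor n) :=
  Set.range fun g : Fin n → Matrix.GeneralLinearGroup (Fin 2) ℂ => act g T

/-- The `SL(2,ℂ)ⁿ`-orbit of a cotensor. -/
def slOrbit {n : ℕ} (T : Cotensor n) : Set (Cotensor n) :=
  Set.range fun g : Fin n → Matrix.SpecialLinearGroup (Fin 2) ℂ =>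
    act (fun k => Matrix.SpecialLinearGroup.toGL (g k)) T

/-- The number of ones in a word. -/
def weight {n : ℕ} (w : Fin n → Fin 2) : ℕ := (Finset.univ.filter fun k => w k = 1).card

/-- The subspace `W_n` of cotensors of even support. -/
def evenSubspace (n : ℕ) : Submodule ℂ (Cotensor n) where
  carrier := {T | ∀ w, Odd (weight w) → T w = 0}
  add_mem' := fun hS hT w hw => by simp [hS w hw, hT w hw]
  zero_mem' := fun _ _ => rfl
  smul_mem' := fun c _ hT w hw => by simp [hT w hw]

/-- The linear projector `P_{W_n}` onto `W_n`, along the cotensors of odd support. -/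
def projEven (n : ℕ) : Cotensor n →ₗ[ℂ] Cotensor n where
  toFun T := fun w => if Even (weight w) then T w else 0
  map_add' S T := by funext w; by_cases h : Even (weight w) <;> simp [h]
  map_smul' c T := by funext w; by_cases h : Even (weight w) <;> simp [h]

theorem projEven_isProj (n : ℕ) : LinearMap.IsProj (evenSubspace n) (projEven n) where
  map_mem T := fun w hw => by simp [projEven, Nat.not_even_iff_odd.mpr hw]
  map_id T hT := by
    funext w
    by_cases h : Even (weight w)
    · simp [projEven, h]
    · simp [projEven, h, hT w (Nat.not_even_iff_odd.mp h)]

end PfaffianCogate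

end

/-! Up to order of factors, $G$ is a product of four pairings, on the 0-based positions (0,2),
(1,3), (4,6), (5,7). Its GL-orbit therefore lies among products of four invertible 2×2 matrices. The
closure of the SL-orbit does too: being such a product is a polynomial condition
(`pairTensor_rank_one`), and the product of the determinants is a quadratic form equal to 1 on the
orbit (`detForm_pairTensor`).

Pfaffian cogates satisfy the quadrics `matchgate`, which follow from row expansion
(`raisePf_eq_sum`) and skew-symmetry. Being homogeneous, these persist on both cones. For odd words
they involve only even coefficients, so the projector disappears from them. Inside each SWAP the two
pairs cross, so with alternating signs equal terms add up instead of cancelling. One family of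
quadrics forces `a 0`, `a 1` or else `a 2`, `a 3` to be diagonal or antidiagonal; a second family
then kills every even coefficient. Hence the projection is zero (`projEven_pairTensor_eq_zero`),
which neither punctured set contains. -/

noncomputable section

namespace PfaffianCogate

section

variable {n : ℕ}

/-! ### Signs and row expansion of Pfaffians -/

/-- The Pfaffian of the principal submatrix `M_I`. -/
def subPf (M : Matrix (Fin n) (Fin n) ℂ) (I : Finset (Fin n)) : ℂ :=
  pfaffian I.card (principal M I)

/-- The sign `(-1)^{#{k ∈ I : k < i}}`. -/
def posSign (I : Finset (Fin n)) (i : Fin n) : ℂ := (-1) ^ (I.filter (· < i)).card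

theorem posSign_mul_self (I : Finset (Fin n)) (i : Fin n) : posSign I i * posSign I i = 1 := by
  rw [posSign, ← pow_add, Even.neg_one_pow ⟨_, rfl⟩]

theorem posSign_insert {I : Finset (Fin n)} {k : Fin n} (hk : k ∉ I) (i : Fin n) :
    posSign (insert k I) i = (if k < i then -1 else 1) * posSign I i := by
  unfold posSign
  rw [Finset.filter_insert]
  split_ifs with h
  · rw [Finset.card_insert_of_notMem (by simp [hk]), pow_succ]; ring
  · simp

theorem posSign_eq_erase {I : Finset (Fin n)} {k : Fin n} (hk : k ∈ I) (i : Fin n) :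
    posSign I i = (if k < i then -1 else 1) * posSign (I.erase k) i := by
  rw [← posSign_insert (Finset.notMem_erase k I), Finset.insert_erase hk]

theorem posSign_erase {I : Finset (Fin n)} {k : Fin n} (hk : k ∈ I) (i : Fin n) :
    posSign (I.erase k) i = (if k < i then -1 else 1) * posSign I i := by
  rw [posSign_eq_erase hk]; split_ifs <;> ring

theorem subPf_image (M : Matrix (Fin n) (Fin n) ℂ) {k : ℕ} {g : Fin k → Fin n}
    (hg : StrictMono g) : subPf M (Finset.univ.image g) = pfaffian k (M.submatrix g g) := by
  obtain ⟨I, hI⟩ : ∃ I, I = Finset.univ.image g := ⟨_, rfl⟩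
  rw [← hI]
  have hc : I.card = k := by
    rw [hI, Finset.card_image_of_injective _ hg.injective, Finset.card_univ, Fintype.card_fin]
  subst hc
  have := Finset.orderEmbOfFin_unique (s := I) rfl (f := g) (fun x => by rw [hI]; simp) hg
  rw [subPf, principal, ← this]

theorem posSign_image {k : ℕ} {g : Fin k → Fin n} (hg : StrictMono g) (j : Fin k) :
    posSign (Finset.univ.image g) (g j) = (-1) ^ (j : ℕ) := by
  rw [posSign, Finset.filter_image, Finset.card_image_of_injective _ hg.injective]
  simp only [hg.lt_iff_lt]
  rw [← Fin.card_Iio j]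
  congr 2
  ext x; simp

theorem erase_image {k : ℕ} {g : Fin (k + 1) → Fin n} (hg : StrictMono g) (j : Fin (k + 1)) :
    (Finset.univ.image g).erase (g j) = Finset.univ.image (g ∘ j.succAbove) := by
  ext x
  simp only [Finset.mem_erase, Finset.mem_image, Finset.mem_univ, true_and, Function.comp]
  constructor
  · rintro ⟨hx, y, rfl⟩
    obtain ⟨z, hz⟩ := Fin.exists_succAbove_eq fun h : y = j => hx (by rw [h])
    exact ⟨z, by rw [hz]⟩
  · rintro ⟨z, rfl⟩
    exact ⟨fun h => Fin.succAbove_ne j z (hg.injective h), _, rfl⟩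

/-- Expansion of a principal Pfaffian along its first row. -/
theorem subPf_insert_min (M : Matrix (Fin n) (Fin n) ℂ) {i : Fin n} {A : Finset (Fin n)}
    (hi : ∀ k ∈ A, i < k) :
    subPf M (insert i A) = ∑ j ∈ A, M i j * (posSign A j * subPf M (A.erase j)) := by
  obtain ⟨k, g, hg, rfl⟩ : ∃ (k : ℕ) (g : Fin k → Fin n), StrictMono g ∧
      A = Finset.univ.image g :=
    ⟨A.card, A.orderEmbOfFin rfl, (A.orderEmbOfFin rfl).strictMono, by simp⟩
  have hcons : StrictMono (Fin.cons i g : Fin (k + 1) → Fin n) := by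
    intro x y hxy
    induction y using Fin.cases with
    | zero => exact absurd hxy (Fin.not_lt_zero x)
    | succ y =>
      induction x using Fin.cases with
      | zero => simpa using hi (g y) (by simp)
      | succ x => simpa using hg (Fin.succ_lt_succ_iff.mp hxy)
  have himg : insert i (Finset.univ.image g) =
      Finset.univ.image (Fin.cons i g : Fin (k + 1) → Fin n) := by
    ext x; simp [Fin.exists_fin_succ, eq_comm]
  rw [himg, subPf_image M hcons, Finset.sum_image hg.injective.injOn]
  cases k with
  | zero => simp [pfaffian]
  | succ k =>
    rw [pfaffian]
    refine Finset.sum_congr rfl fun j _ => ?_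
    rw [posSign_image hg, erase_image hg, subPf_image M (hg.comp (Fin.strictMono_succAbove j))]
    simp only [Matrix.submatrix_apply, Matrix.submatrix_submatrix, Fin.cons_zero, Fin.cons_succ]
    have : (Fin.cons i g : Fin (k + 2) → Fin n) ∘ (fun x => (j.succAbove x).succ) =
        g ∘ j.succAbove := by
      funext x; simp
    rw [this]; ring

/-- Lowering: `±Pf(M_{A \ j})` for `j ∈ A`, and zero otherwise. -/
def lowerPf (M : Matrix (Fin n) (Fin n) ℂ) (A : Finset (Fin n)) (j : Fin n) : ℂ :=
  if j ∈ A then posSign A j * subPf M (A.erase j) else 0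

/-- Raising: `±Pf(M_{A ∪ i})` for `i ∉ A`, and zero otherwise. -/
def raisePf (M : Matrix (Fin n) (Fin n) ℂ) (A : Finset (Fin n)) (i : Fin n) : ℂ :=
  if i ∈ A then 0 else posSign A i * subPf M (insert i A)

theorem sum_mul_lowerPf (M : Matrix (Fin n) (Fin n) ℂ) (A : Finset (Fin n)) (i : Fin n) :
    ∑ j, M i j * lowerPf M A j = ∑ j ∈ A, M i j * (posSign A j * subPf M (A.erase j)) := by
  simp [lowerPf, Finset.sum_ite_mem]

/-- Removing the smaller index first changes the sign of the larger one; the other order changes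
nothing. -/
theorem posSign_mul_posSign_erase {A : Finset (Fin n)} {j k : Fin n} (hj : j ∈ A) (hk : k ∈ A)
    (hjk : j ≠ k) :
    posSign A j * posSign (A.erase j) k = -(posSign A k * posSign (A.erase k) j) := by
  rw [posSign_erase hj, posSign_erase hk]
  rcases lt_or_gt_of_ne hjk with h | h
  · simp [h, h.not_gt]; ring
  · simp [h, h.not_gt]; ring

/-- Exchanging the two indices of a double lowering changes the sign. -/
theorem sum_sum_lower_swap (x y : Fin n → ℂ) (M : Matrix (Fin n) (Fin n) ℂ)
    (A : Finset (Fin n)) :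
    ∑ j ∈ A, x j * (posSign A j *
        ∑ k ∈ A.erase j, y k * (posSign (A.erase j) k * subPf M ((A.erase j).erase k))) =
      -∑ k ∈ A, y k * (posSign A k *
        ∑ j ∈ A.erase k, x j * (posSign (A.erase k) j * subPf M ((A.erase k).erase j))) := by
  simp only [Finset.mul_sum, ← Finset.sum_neg_distrib]
  rw [Finset.sum_comm' (t' := A) (s' := fun k => A.erase k)
    (by intro a b; simp only [Finset.mem_erase]; tauto)]
  refine Finset.sum_congr rfl fun k hk => Finset.sum_congr rfl fun j hj => ?_
  have hj' := Finset.mem_erase.mp hj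
  have := posSign_mul_posSign_erase hj'.2 hk hj'.1
  rw [Finset.erase_right_comm (a := k) (b := j)]
  linear_combination (x j * y k * subPf M ((A.erase j).erase k)) * this

theorem posSign_eq_one {A : Finset (Fin n)} {i : Fin n} (h : ∀ k ∈ A, i ≤ k) :
    posSign A i = 1 := by
  rw [posSign, Finset.filter_false_of_mem fun k hk => (h k hk).not_gt]; simp

/-- Expansion of Pfaffians along an arbitrary row, including the vanishing of expansions along
alien rows. -/
theorem raisePf_eq_sum {M : Matrix (Fin n) (Fin n) ℂ} (hM : ∀ i j, M i j = -M j i)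
    (A : Finset (Fin n)) (i : Fin n) : raisePf M A i = ∑ j, M i j * lowerPf M A j := by
  rw [sum_mul_lowerPf]
  induction A using Finset.strongInduction generalizing i with
  | H A ih =>
  have hdiag : M i i = 0 := self_eq_neg.mp (hM i i)
  by_cases hmin : ∀ k ∈ A, i < k
  · rw [raisePf, if_neg fun h => lt_irrefl _ (hmin i h), ← subPf_insert_min M hmin,
      posSign_eq_one fun k hk => (hmin k hk).le, one_mul]
  have hA : A.Nonempty := by
    push Not at hmin; exact ⟨_, hmin.choose_spec.1⟩
  -- The minimum `m` is split off because the definition only expands along the first row.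
  obtain ⟨m, hm, B, hmB, rfl⟩ : ∃ m, m ∈ A ∧ ∃ B : Finset (Fin n), (∀ k ∈ B, m < k) ∧
      insert m B = A := by
    refine ⟨A.min' hA, A.min'_mem hA, A.erase (A.min' hA), fun k hk => ?_,
      Finset.insert_erase (A.min'_mem hA)⟩
    exact A.min'_lt_of_mem_erase_min' hA hk
  have hmnot : m ∉ B := fun h => lt_irrefl _ (hmB m h)
  have hmi : m ≤ i := by
    push Not at hmin
    obtain ⟨k, hk, hki⟩ := hmin
    rcases Finset.mem_insert.mp hk with rfl | hk
    · exact hki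
    · exact (hmB k hk).le.trans hki
  -- Expanding along `m` and exchanging the two lowerings leaves row-`i` sums over the smaller sets
  -- `B.erase k`, where induction applies.
  have key : ∑ j ∈ insert m B, M i j * (posSign (insert m B) j * subPf M ((insert m B).erase j)) =
      M i m * subPf M B + ∑ k ∈ B, M m k * (posSign B k *
        ∑ j ∈ B.erase k, M i j * (posSign (B.erase k) j * subPf M ((B.erase k).erase j))) := by
    rw [Finset.sum_insert hmnot, Finset.erase_insert hmnot, posSign_eq_one, one_mul]
    · congr 1
      rw [← neg_inj, ← sum_sum_lower_swap (fun j => M i j) (fun k => M m k) M B,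
        ← Finset.sum_neg_distrib]
      refine Finset.sum_congr rfl fun j hj => ?_
      rw [posSign_insert hmnot, if_pos (hmB j hj),
        Finset.erase_insert_of_ne (ne_of_mem_of_not_mem hj hmnot).symm,
        subPf_insert_min M fun k hk => hmB k (Finset.mem_of_mem_erase hk)]
      ring
    · intro k hk
      rcases Finset.mem_insert.mp hk with rfl | hk
      · exact le_rfl
      · exact (hmB k hk).le
  rw [key]
  -- For `i = m` the double sum is its own negative.
  rcases hmi.eq_or_lt with rfl | hlt
  · have := sum_sum_lower_swap (fun j => M m j) (fun k => M m k) M B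
    rw [raisePf, if_pos (Finset.mem_insert_self _ _), hdiag, self_eq_neg.mp this]; simp
  have hs : ∀ k ∈ B, ∑ j ∈ B.erase k, M i j *
      (posSign (B.erase k) j * subPf M ((B.erase k).erase j)) = raisePf M (B.erase k) i :=
    fun k hk => (ih _ ((Finset.erase_ssubset hk).trans (Finset.ssubset_insert hmnot)) i).symm
  rw [Finset.sum_congr rfl fun k hk => by rw [hs k hk]]
  -- For `i ∈ B` only `k = i` survives, and it cancels `M i m * subPf M B` by skew-symmetry.
  by_cases hiB : i ∈ B
  · rw [raisePf, if_pos (Finset.mem_insert_of_mem hiB), Finset.sum_eq_single_of_mem i hiB]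
    · rw [raisePf, if_neg (Finset.notMem_erase _ _), Finset.insert_erase hiB, posSign_erase hiB,
        hM m i]
      simp only [lt_irrefl, if_false]
      linear_combination (M i m * subPf M B) * posSign_mul_self B i
    · intro k hk hki
      rw [raisePf, if_pos (Finset.mem_erase.mpr ⟨hki.symm, hiB⟩)]; simp
  · have hinot : i ∉ insert m B := by
      rw [Finset.mem_insert]; rintro (h | h)
      · exact hlt.ne' h
      · exact hiB h
    rw [raisePf, if_neg hinot, Finset.insert_comm, subPf_insert_min M, Finset.sum_insert hiB,
      Finset.erase_insert hiB, posSign_insert hmnot, if_pos hlt, posSign_insert hiB,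
      if_neg (lt_irrefl i), mul_add]
    · congr 1
      · rw [hM m i]; linear_combination (M i m * subPf M B) * posSign_mul_self B i
      · rw [Finset.mul_sum]
        refine Finset.sum_congr rfl fun k hk => ?_
        have hik : i ≠ k := fun h => hiB (h ▸ hk)
        rw [raisePf, if_neg fun h => hiB (Finset.mem_of_mem_erase h), posSign_erase hk,
          posSign_insert hiB, Finset.erase_insert_of_ne hik]
        rcases lt_or_gt_of_ne hik with h | h
        · simp [h, h.not_gt]; ring
        · simp [h, h.not_gt]; ring
    · intro k hk
      rcases Finset.mem_insert.mp hk with rfl | hk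
      · exact hlt
      · exact hmB k hk

/-- The quadratic relations between principal Pfaffians. -/
theorem sum_raisePf_mul_lowerPf {M : Matrix (Fin n) (Fin n) ℂ} (hM : ∀ i j, M i j = -M j i)
    (A B : Finset (Fin n)) :
    ∑ i, (raisePf M A i * lowerPf M B i + lowerPf M A i * raisePf M B i) = 0 := by
  simp only [raisePf_eq_sum hM, Finset.sum_add_distrib, Finset.sum_mul, Finset.mul_sum]
  rw [Finset.sum_comm, ← Finset.sum_add_distrib]
  refine Finset.sum_eq_zero fun i _ => ?_
  rw [← Finset.sum_add_distrib]
  refine Finset.sum_eq_zero fun j _ => ?_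
  rw [hM j i]; ring

/-! ### Matchgate quadrics and their vanishing on cogates -/

/-- The positions of the zeros of a word. -/
def zeros (w : Fin n → Fin 2) : Finset (Fin n) := Finset.univ.filter fun k => w k = 0

theorem mem_zeros {w : Fin n → Fin 2} {i : Fin n} : i ∈ zeros w ↔ w i = 0 :=
  Finset.mem_filter_univ i

/-- The word `w` with its `i`-th letter exchanged. -/
def flip (w : Fin n → Fin 2) (i : Fin n) : Fin n → Fin 2 := Function.update w i (w i + 1)

/-- The matchgate quadric of a pair of words. -/
def matchgate (u v : Fin n → Fin 2) (T : Cotensor n) : ℂ :=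
  ∑ i, if u i = v i then 0 else
    posSign (zeros u) i * posSign (zeros v) i * (T (flip u i) * T (flip v i))

theorem matchgate_smul (u v : Fin n → Fin 2) (c : ℂ) (T : Cotensor n) :
    matchgate u v (c • T) = c ^ 2 * matchgate u v T := by
  simp only [matchgate, Finset.mul_sum, Pi.smul_apply, smul_eq_mul]
  refine Finset.sum_congr rfl fun i _ => ?_
  split_ifs <;> ring

theorem zeros_flip (w : Fin n → Fin 2) (i : Fin n) :
    zeros (flip w i) = if i ∈ zeros w then (zeros w).erase i else insert i (zeros w) := by
  have h2 : ∀ x : Fin 2, x + 1 = 0 ↔ ¬ x = 0 := by decide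
  ext k
  rw [mem_zeros, flip]
  rcases eq_or_ne k i with rfl | hk
  · by_cases h : w k = 0 <;> simp [mem_zeros, h, h2]
  · by_cases h : w i = 0 <;> simp [mem_zeros, h, hk]

theorem zeros_eq_iff (w : Fin n → Fin 2) (I : Finset (Fin n)) :
    w = indicatorWord Iᶜ ↔ I = zeros w := by
  have h2 : ∀ x : Fin 2, x ≠ 0 → x = 1 := by decide
  constructor
  · rintro rfl; ext k; by_cases h : k ∈ I <;> simp [zeros, indicatorWord, h]
  · rintro rfl; funext k; by_cases h : w k = 0 <;> simp [zeros, indicatorWord, h]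
    exact h2 _ h

theorem sPfDual_apply (M : Matrix (Fin n) (Fin n) ℂ) (w : Fin n → Fin 2) :
    sPfDual M w = subPf M (zeros w) := by
  rw [sPfDual, Finset.sum_apply, Finset.sum_eq_single (zeros w)]
  · simp [bra, braWord, subPf, ← (zeros_eq_iff w (zeros w)).mpr rfl]
  · intro I _ hI
    have : w ≠ indicatorWord Iᶜ := fun h => hI ((zeros_eq_iff w I).mp h)
    simp [bra, braWord, Pi.single_eq_of_ne this]
  · simp

theorem matchgate_sPfDual {M : Matrix (Fin n) (Fin n) ℂ} (hM : M.transpose = -M)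
    (u v : Fin n → Fin 2) : matchgate u v (sPfDual M) = 0 := by
  have hM' : ∀ i j, M i j = -M j i := fun i j => congrFun (congrFun hM j) i
  rw [← sum_raisePf_mul_lowerPf hM' (zeros u) (zeros v)]
  refine Finset.sum_congr rfl fun i _ => ?_
  have h2 : ∀ x y : Fin 2, x ≠ y → (x = 0 ↔ ¬ y = 0) := by decide
  simp only [sPfDual_apply, zeros_flip, raisePf, lowerPf]
  by_cases h : u i = v i
  · have h' : i ∈ zeros u ↔ i ∈ zeros v := by rw [mem_zeros, mem_zeros, h]
    by_cases hu : i ∈ zeros v <;> simp [h, h', hu]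
  · have h' : i ∈ zeros u ↔ ¬ i ∈ zeros v := by rw [mem_zeros, mem_zeros, h2 _ _ h]
    by_cases hu : i ∈ zeros v <;> simp [h, h', hu] <;> ring

end

/-! ### Products of four pairings and the action on them -/

/-- The product cotensor pairing the positions `(0,2)`, `(1,3)`, `(4,6)`, `(5,7)`. -/
def pairTensor (a : Fin 4 → Matrix (Fin 2) (Fin 2) ℂ) : Cotensor 8 := fun w =>
  a 0 (w 0) (w 2) * a 1 (w 1) (w 3) * a 2 (w 4) (w 6) * a 3 (w 5) (w 7)

theorem SWAP_apply (v : Fin 4 → Fin 2) :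
    SWAP v = (1 : Matrix (Fin 2) (Fin 2) ℂ) (v 0) (v 2) *
      (1 : Matrix (Fin 2) (Fin 2) ℂ) (v 1) (v 3) := by
  obtain ⟨x, y, z, t, rfl⟩ : ∃ x y z t, v = ![x, y, z, t] :=
    ⟨v 0, v 1, v 2, v 3, by funext i; fin_cases i <;> rfl⟩
  simp only [SWAP, braWord, Pi.add_apply, Pi.single_apply, Matrix.one_apply]
  fin_cases x <;> fin_cases y <;> fin_cases z <;> fin_cases t <;> simp

theorem tensor_SWAP_SWAP : (tensor SWAP SWAP : Cotensor 8) = pairTensor fun _ => 1 := by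
  funext w
  simp only [tensor, SWAP_apply, pairTensor, ← mul_assoc]
  rfl

/-- The index of the pair that contains a position. -/
def pairIndex : Fin 8 → Fin 4 := ![0, 1, 0, 1, 2, 3, 2, 3]

theorem prod_pairIndex (e : Fin 8 → Fin 2 → ℂ) (x : Fin 4 → Fin 2) :
    ∏ k, e k (x (pairIndex k)) =
      ∏ j, e (![0, 1, 4, 5] j) (x j) * e (![2, 3, 6, 7] j) (x j) := by
  simp only [Fin.prod_univ_eight, Fin.prod_univ_four, pairIndex, Matrix.cons_val]
  ring

theorem sum_prod_pairIndex (e : Fin 8 → Fin 2 → ℂ) :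
    ∑ x : Fin 4 → Fin 2, ∏ k, e k (x (pairIndex k)) =
      ∏ j, ∑ t, e (![0, 1, 4, 5] j) t * e (![2, 3, 6, 7] j) t := by
  simp only [prod_pairIndex]
  exact (Fintype.prod_sum fun j t => e (![0, 1, 4, 5] j) t * e (![2, 3, 6, 7] j) t).symm

theorem pairTensor_one_eq_sum (u : Fin 8 → Fin 2) :
    pairTensor (fun _ => 1) u =
      ∑ x : Fin 4 → Fin 2, ∏ k, if x (pairIndex k) = u k then (1 : ℂ) else 0 := by
  rw [sum_prod_pairIndex fun k t => if t = u k then (1 : ℂ) else 0, Fin.prod_univ_four]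
  simp only [pairTensor, Matrix.one_apply, ite_mul, one_mul, zero_mul, Finset.sum_ite_eq',
    Finset.mem_univ, if_true]
  rfl

/-- A pairing transforms as a bilinear form, by congruence with a different matrix on each side. -/
theorem act_pairTensor_one (g : Fin 8 → Matrix.GeneralLinearGroup (Fin 2) ℂ) :
    act g (pairTensor fun _ => 1) = pairTensor fun j =>
      ((g (![0, 1, 4, 5] j))⁻¹.val).transpose * (g (![2, 3, 6, 7] j))⁻¹.val := by
  funext w
  simp only [act, pairTensor_one_eq_sum, Finset.sum_mul, ← Finset.prod_mul_distrib]
  rw [Finset.sum_comm]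
  have h1 : ∀ x : Fin 4 → Fin 2, ∑ u : Fin 8 → Fin 2,
      ∏ k, (if x (pairIndex k) = u k then (1 : ℂ) else 0) * (g k)⁻¹.val (u k) (w k) =
      ∏ k, (g k)⁻¹.val (x (pairIndex k)) (w k) := fun x => by
    rw [← Fintype.prod_sum fun k t =>
      (if x (pairIndex k) = t then (1 : ℂ) else 0) * (g k)⁻¹.val t (w k)]
    simp only [ite_mul, one_mul, zero_mul, Finset.sum_ite_eq, Finset.mem_univ, if_true]
  simp only [h1]
  rw [sum_prod_pairIndex fun k t => (g k)⁻¹.val t (w k), Fin.prod_univ_four]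
  simp only [pairTensor, Matrix.mul_apply, Matrix.transpose_apply]
  rfl

/-! ### Quadrics on the cones, and the two orbits -/

theorem zariskiClosure_induction {n : ℕ} {S : Set (Cotensor n)} {T : Cotensor n}
    (hT : T ∈ zariskiClosure S) (p : MvPolynomial (Fin n → Fin 2) ℂ)
    (hp : ∀ x ∈ S, MvPolynomial.aeval x p = 0) : MvPolynomial.aeval T p = 0 :=
  hT p hp

theorem matchgate_cone {n : ℕ} {T : Cotensor n} (hT : T ∈ cone n) (u v : Fin n → Fin 2) :
    matchgate u v T = 0 := by
  let p : MvPolynomial (Fin n → Fin 2) ℂ := ∑ i, if u i = v i then 0 else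
    MvPolynomial.C (posSign (zeros u) i * posSign (zeros v) i) *
      (MvPolynomial.X (flip u i) * MvPolynomial.X (flip v i))
  have hp : ∀ x : Cotensor n, MvPolynomial.aeval x p = matchgate u v x := fun x => by
    simp only [p, matchgate, map_sum]
    refine Finset.sum_congr rfl fun i _ => ?_
    split_ifs <;> simp
  rw [← hp]
  refine zariskiClosure_induction hT p ?_
  rintro _ ⟨c, _, ⟨M, hM, rfl⟩, rfl⟩
  rw [hp, matchgate_smul, matchgate_sPfDual hM, mul_zero]

theorem matchgate_puncturedCone {n : ℕ} {T : Cotensor n} (hT : T ∈ puncturedCone n)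
    (u v : Fin n → Fin 2) : matchgate u v T = 0 := by
  obtain ⟨c, -, _, ⟨M, hM, rfl⟩, rfl⟩ := hT
  rw [matchgate_smul, matchgate_sPfDual hM, mul_zero]

theorem ne_zero_of_mem_puncturedCone {n : ℕ} {T : Cotensor n} (hT : T ∈ puncturedCone n) :
    T ≠ 0 := by
  obtain ⟨c, hc, _, ⟨M, hM, rfl⟩, rfl⟩ := hT
  intro h
  -- The all-ones word carries the empty Pfaffian, so its coefficient is `c`.
  have := congrFun h fun _ => 1
  rw [Pi.smul_apply, sPfDual_apply] at this
  have hz : zeros (fun _ : Fin n => (1 : Fin 2)) = Finset.univ.image (Fin.elim0 : Fin 0 → Fin n) := by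
    ext; simp [mem_zeros]
  rw [hz, subPf_image M (fun x => x.elim0)] at this
  simp [pfaffian, hc] at this

theorem glOrbit_subset {T : Cotensor 8} (hT : T ∈ glOrbit (tensor SWAP SWAP : Cotensor 8)) :
    ∃ a, (∀ j, (a j).det ≠ 0) ∧ T = pairTensor a := by
  obtain ⟨g, rfl⟩ := hT
  refine ⟨_, fun j => ?_, by rw [tensor_SWAP_SWAP]; exact act_pairTensor_one g⟩
  rw [Matrix.det_mul, Matrix.det_transpose]
  exact mul_ne_zero (Matrix.GeneralLinearGroup.det_ne_zero _)
    (Matrix.GeneralLinearGroup.det_ne_zero _)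

theorem slOrbit_subset {T : Cotensor 8} (hT : T ∈ slOrbit (tensor SWAP SWAP : Cotensor 8)) :
    ∃ a, (∀ j, (a j).det = 1) ∧ T = pairTensor a := by
  obtain ⟨g, rfl⟩ := hT
  refine ⟨_, fun j => ?_, by
    show act _ (tensor SWAP SWAP : Cotensor 8) = _
    rw [tensor_SWAP_SWAP]; exact act_pairTensor_one _⟩
  rw [Matrix.det_mul, Matrix.det_transpose]
  simp [← map_inv, Matrix.det_adjugate]

/-! ### Closure of the SL-orbit -/

/-- The word with the pairs `x j, y j` in the positions paired by `pairTensor`. -/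
def pairWord (x y : Fin 4 → Fin 2) : Fin 8 → Fin 2 :=
  ![x 0, x 1, y 0, y 1, x 2, x 3, y 2, y 3]

theorem pairTensor_pairWord (a : Fin 4 → Matrix (Fin 2) (Fin 2) ℂ) (x y : Fin 4 → Fin 2) :
    pairTensor a (pairWord x y) = ∏ j, a j (x j) (y j) := by
  simp [pairTensor, pairWord, Fin.prod_univ_four]

theorem eq_pairWord (w : Fin 8 → Fin 2) :
    w = pairWord ![w 0, w 1, w 4, w 5] ![w 2, w 3, w 6, w 7] := by
  funext i; fin_cases i <;> rfl

/-- A quadratic form whose value on a product of pairings is the product of their determinants. -/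
def detForm (T : Cotensor 8) : ℂ := ∑ y : Fin 4 → Fin 2,
  (∏ j, (-1) ^ (y j : ℕ)) * (T (pairWord 0 y) * T (pairWord 1 (y + 1)))

theorem detForm_pairTensor (a : Fin 4 → Matrix (Fin 2) (Fin 2) ℂ) :
    detForm (pairTensor a) = ∏ j, (a j).det := by
  simp only [detForm, pairTensor_pairWord, ← Finset.prod_mul_distrib]
  rw [← Fintype.piFinset_univ]
  simp only [Pi.add_apply, Pi.zero_apply, Pi.one_apply]
  rw [← Finset.prod_univ_sum (fun _ => Finset.univ)
    fun j (t : Fin 2) => (-1 : ℂ) ^ (t : ℕ) * (a j 0 t * a j 1 (t + 1))]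
  refine Finset.prod_congr rfl fun j _ => ?_
  simp [Matrix.det_fin_two, Fin.sum_univ_two]; ring

/-- Polynomial equations for rank one across the four pairs: each factor on the right changes one
pair of the base word, leaving three base entries of every matrix. -/
theorem pairTensor_rank_one (a : Fin 4 → Matrix (Fin 2) (Fin 2) ℂ) (x y p q : Fin 4 → Fin 2) :
    pairTensor a (pairWord x y) * pairTensor a (pairWord p q) ^ 3 =
      ∏ j, pairTensor a (pairWord (Function.update p j (x j)) (Function.update q j (y j))) := by
  simp [pairTensor, pairWord, Fin.prod_univ_four, Function.update]
  ring

theorem zariskiClosure_slOrbit_subset {T : Cotensor 8}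
    (hT : T ∈ zariskiClosure (slOrbit (tensor SWAP SWAP : Cotensor 8))) :
    ∃ a, (∀ j, (a j).det ≠ 0) ∧ T = pairTensor a := by
  have hdet : detForm T = 1 := by
    have := zariskiClosure_induction hT ((∑ y : Fin 4 → Fin 2,
      MvPolynomial.C (∏ j, (-1) ^ (y j : ℕ)) * (MvPolynomial.X (pairWord 0 y) *
        MvPolynomial.X (pairWord 1 (y + 1)))) - 1) (by
      intro x hx
      obtain ⟨a, ha, rfl⟩ := slOrbit_subset hx
      have := detForm_pairTensor a
      simp only [ha, Finset.prod_const_one, detForm] at this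
      simp only [map_sub, map_one, map_sum, map_mul, MvPolynomial.aeval_X, MvPolynomial.aeval_C,
        Algebra.algebraMap_self, RingHom.id_apply, this, sub_self])
    simp only [map_sub, map_one, map_sum, map_mul, MvPolynomial.aeval_X, MvPolynomial.aeval_C,
      Algebra.algebraMap_self, RingHom.id_apply] at this
    exact sub_eq_zero.mp this
  have hprod : ∀ x y p q : Fin 4 → Fin 2, T (pairWord x y) * T (pairWord p q) ^ 3 =
      ∏ j, T (pairWord (Function.update p j (x j)) (Function.update q j (y j))) := by
    intro x y p q
    have := zariskiClosure_induction hT (MvPolynomial.X (pairWord x y) *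
      MvPolynomial.X (pairWord p q) ^ 3 - ∏ j, MvPolynomial.X
        (pairWord (Function.update p j (x j)) (Function.update q j (y j)))) (by
      intro t ht
      obtain ⟨a, -, rfl⟩ := slOrbit_subset ht
      simp only [map_sub, map_prod, map_mul, map_pow, MvPolynomial.aeval_X,
        pairTensor_rank_one, sub_self])
    simp only [map_sub, map_prod, map_mul, map_pow, MvPolynomial.aeval_X] at this
    exact sub_eq_zero.mp this
  obtain ⟨w, hw⟩ : ∃ w, T w ≠ 0 := by
    by_contra! h
    simp [detForm, h] at hdet
  rw [eq_pairWord w] at hw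
  set p : Fin 4 → Fin 2 := ![w 0, w 1, w 4, w 5]
  set q : Fin 4 → Fin 2 := ![w 2, w 3, w 6, w 7]
  set t := T (pairWord p q)
  -- The factors are the slices of `T` through a nonzero entry `t`, divided by `t`; the scale `t` is
  -- restored once, in factor 0.
  let a : Fin 4 → Matrix (Fin 2) (Fin 2) ℂ := fun j r s =>
    (if j = 0 then t else 1) * t⁻¹ *
      T (pairWord (Function.update p j r) (Function.update q j s))
  have hTa : T = pairTensor a := by
    funext z
    rw [eq_pairWord z, pairTensor_pairWord]
    simp only [a, Finset.prod_mul_distrib, ← hprod]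
    simp only [Finset.prod_ite_eq', Finset.mem_univ, if_true, Finset.prod_const,
      Finset.card_univ, Fintype.card_fin]
    change _ = t * t⁻¹ ^ 4 * (_ * t ^ 3)
    field_simp
  refine ⟨a, fun j hj => ?_, hTa⟩
  rw [hTa, detForm_pairTensor, Finset.prod_eq_zero (Finset.mem_univ j) hj] at hdet
  exact zero_ne_one hdet

/-! ### Signs and parity for pairs of odd words -/

theorem posSign_eq_prod {n : ℕ} (I : Finset (Fin n)) (i : Fin n) :
    posSign I i = ∏ k, if k ∈ I ∧ k < i then (-1 : ℂ) else 1 := by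
  rw [posSign, Finset.prod_ite, Finset.prod_const, Finset.prod_const_one, mul_one,
    ← Finset.filter_filter]
  simp

theorem posSign_zeros_mul {n : ℕ} (u v : Fin n → Fin 2) (i : Fin n) :
    posSign (zeros u) i * posSign (zeros v) i =
      ∏ k, if k < i ∧ u k ≠ v k then (-1 : ℂ) else 1 := by
  rw [posSign_eq_prod, posSign_eq_prod, ← Finset.prod_mul_distrib]
  refine Finset.prod_congr rfl fun k _ => ?_
  have h2 : ∀ x y : Fin 2, x ≠ y ↔ (x = 0 ↔ ¬ y = 0) := by decide
  simp only [mem_zeros, h2]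
  by_cases hk : k < i <;> by_cases hu : u k = 0 <;> by_cases hv : v k = 0 <;> simp [hk, hu, hv]

theorem even_weight_iff {n : ℕ} (w : Fin n → Fin 2) : Even (weight w) ↔ ∑ k, w k = 0 := by
  have h1 : ∀ x : Fin 2, x = if x = 1 then 1 else 0 := by decide
  -- `Fin 2` and `ZMod 2` agree definitionally, so the sum of letters is the weight mod 2.
  have : ∑ k, w k = ((weight w : ℕ) : ZMod 2) := by
    rw [weight, Finset.card_filter, Nat.cast_sum]
    refine Finset.sum_congr rfl fun k _ => ?_
    push_cast
    exact h1 (w k)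
  rw [this]
  exact (ZMod.natCast_eq_zero_iff_even).symm

theorem even_weight_flip {n : ℕ} {w : Fin n → Fin 2} (hw : Odd (weight w)) (i : Fin n) :
    Even (weight (flip w i)) := by
  have h2 : ∀ x y : Fin 2, x + y ≠ 0 → x + 1 + y = 0 := by decide
  rw [← Nat.not_even_iff_odd, even_weight_iff, ← Finset.add_sum_erase _ _ (Finset.mem_univ i)] at hw
  rw [even_weight_iff, ← Finset.add_sum_erase _ _ (Finset.mem_univ i)]
  convert! h2 _ _ hw using 2
  · simp [flip]
  · refine Finset.sum_congr rfl fun k hk => ?_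
    rw [flip, Function.update_of_ne (Finset.ne_of_mem_erase hk)]

theorem matchgate_projEven {n : ℕ} {u v : Fin n → Fin 2} (hu : Odd (weight u))
    (hv : Odd (weight v)) (T : Cotensor n) :
    matchgate u v (projEven n T) = ∑ i, if u i = v i then 0 else
      (∏ k, if k < i ∧ u k ≠ v k then (-1 : ℂ) else 1) * (T (flip u i) * T (flip v i)) := by
  have : ∀ w, Odd (weight w) → ∀ i, projEven n T (flip w i) = T (flip w i) := fun w hw i =>
    if_pos (even_weight_flip hw i)
  simp only [matchgate, this u hu, this v hv, posSign_zeros_mul]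

/-! ### Monomial 2×2 matrices -/

/-- The product of the diagonal or antidiagonal entries of a `2 × 2` matrix. -/
def parityProd (a : Matrix (Fin 2) (Fin 2) ℂ) (p : Fin 2) : ℂ := a 0 p * a 1 (p + 1)

theorem parityProd_add (m : Matrix (Fin 2) (Fin 2) ℂ) (x y : Fin 2) :
    m x y * m (x + 1) (y + 1) = parityProd m (x + y) := by
  fin_cases x <;> fin_cases y <;> simp [parityProd] <;> ring

theorem parityProd_eq (m : Matrix (Fin 2) (Fin 2) ℂ) (p : Fin 2) :
    parityProd m p = m p 0 * m (p + 1) 1 := by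
  simpa using (parityProd_add m p 0).symm

/-- A matrix both of whose columns have a zero entry. -/
def ColMonomial (m : Matrix (Fin 2) (Fin 2) ℂ) : Prop := ∀ y, m 0 y * m 1 y = 0

theorem ColMonomial.parityProd_mul {m : Matrix (Fin 2) (Fin 2) ℂ} (hm : ColMonomial m)
    (p : Fin 2) : parityProd m p * parityProd m (p + 1) = 0 := by
  have h2 : ∀ p : Fin 2, p + 1 + 1 = p := by decide
  rw [parityProd, parityProd, h2]
  linear_combination (m 0 (p + 1) * m 1 (p + 1)) * hm p

theorem ColMonomial.parityProd_ne_zero {m : Matrix (Fin 2) (Fin 2) ℂ} (hm : ColMonomial m)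
    (hd : m.det ≠ 0) {x y : Fin 2} (h : m x y ≠ 0) : parityProd m (x + y) ≠ 0 := by
  have hc : m (x + 1) y = 0 := by
    have := hm y
    fin_cases x <;> simp_all
  intro h0
  rw [← parityProd_add] at h0
  apply hd
  rw [Matrix.det_fin_two]
  fin_cases x <;> fin_cases y <;> simp_all

/-! ### Quadrics of words differing in four positions -/

variable {a : Fin 4 → Matrix (Fin 2) (Fin 2) ℂ}

/-- The words differ at 0, 1, 2, 4, with signs +, −, +, −. Flips at 0 and 2 give one term of `(a
0).det`, flips at 1 and 4 the other, each twice. The letter `p` makes both words odd. -/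
theorem det_mul_one_two (h : ∀ u v, matchgate u v (projEven 8 (pairTensor a)) = 0)
    (y v s t : Fin 2) :
    (a 0).det * (a 1 0 y * a 1 1 y) * (a 2 0 v * a 2 1 v) * a 3 s t ^ 2 = 0 := by
  obtain ⟨p, hp⟩ : ∃ p, p = 1 + y + s + v + t := ⟨_, rfl⟩
  have := h ![p, 0, 0, y, 0, s, v, t] ![p + 1, 1, 1, y, 1, s, v, t]
  rw [matchgate_projEven (by rw [hp]; clear * -; decide +revert)
    (by rw [hp]; clear * -; decide +revert)] at this
  clear hp
  simp [Fin.sum_univ_eight, Fin.prod_univ_eight, flip, pairTensor] at this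
  rw [Matrix.det_fin_two]
  obtain rfl | rfl : p = 0 ∨ p = 1 := by clear * -; decide +revert
  · simp only [zero_add, Fin.reduceAdd] at this
    linear_combination (-1 / 2) * this
  · simp only [Fin.reduceAdd] at this
    linear_combination (1 / 2) * this

theorem det_mul_one_three (h : ∀ u v, matchgate u v (projEven 8 (pairTensor a)) = 0)
    (y v s t : Fin 2) :
    (a 0).det * (a 1 0 y * a 1 1 y) * (a 3 0 v * a 3 1 v) * a 2 s t ^ 2 = 0 := by
  obtain ⟨p, hp⟩ : ∃ p, p = 1 + y + s + v + t := ⟨_, rfl⟩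
  have := h ![p, 0, 0, y, s, 0, t, v] ![p + 1, 1, 1, y, s, 1, t, v]
  rw [matchgate_projEven (by rw [hp]; clear * -; decide +revert)
    (by rw [hp]; clear * -; decide +revert)] at this
  clear hp
  simp [Fin.sum_univ_eight, Fin.prod_univ_eight, flip, pairTensor] at this
  rw [Matrix.det_fin_two]
  obtain rfl | rfl : p = 0 ∨ p = 1 := by clear * -; decide +revert
  · simp only [zero_add, Fin.reduceAdd] at this
    linear_combination (-1 / 2) * this
  · simp only [Fin.reduceAdd] at this
    linear_combination (1 / 2) * this

/-- Now the words differ at 1, 2, 3, 4. Pair 0 varies in its second position, so products along its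
rows appear. -/
theorem det_mul_zero_two (h : ∀ u v, matchgate u v (projEven 8 (pairTensor a)) = 0)
    (y v s t : Fin 2) :
    (a 1).det * (a 0 y 0 * a 0 y 1) * (a 2 0 v * a 2 1 v) * a 3 s t ^ 2 = 0 := by
  obtain ⟨p, hp⟩ : ∃ p, p = 1 + y + s + v + t := ⟨_, rfl⟩
  have := h ![y, p, 0, 0, 0, s, v, t] ![y, p + 1, 1, 1, 1, s, v, t]
  rw [matchgate_projEven (by rw [hp]; clear * -; decide +revert)
    (by rw [hp]; clear * -; decide +revert)] at this
  clear hp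
  simp [Fin.sum_univ_eight, Fin.prod_univ_eight, flip, pairTensor] at this
  rw [Matrix.det_fin_two]
  obtain rfl | rfl : p = 0 ∨ p = 1 := by clear * -; decide +revert
  · simp only [zero_add, Fin.reduceAdd] at this
    linear_combination (-1 / 2) * this
  · simp only [Fin.reduceAdd] at this
    linear_combination (1 / 2) * this

theorem det_mul_zero_three (h : ∀ u v, matchgate u v (projEven 8 (pairTensor a)) = 0)
    (y v s t : Fin 2) :
    (a 1).det * (a 0 y 0 * a 0 y 1) * (a 3 0 v * a 3 1 v) * a 2 s t ^ 2 = 0 := by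
  obtain ⟨p, hp⟩ : ∃ p, p = 1 + y + s + v + t := ⟨_, rfl⟩
  have := h ![y, p, 0, 0, s, 0, t, v] ![y, p + 1, 1, 1, s, 1, t, v]
  rw [matchgate_projEven (by rw [hp]; clear * -; decide +revert)
    (by rw [hp]; clear * -; decide +revert)] at this
  clear hp
  simp [Fin.sum_univ_eight, Fin.prod_univ_eight, flip, pairTensor] at this
  rw [Matrix.det_fin_two]
  obtain rfl | rfl : p = 0 ∨ p = 1 := by clear * -; decide +revert
  · simp only [zero_add, Fin.reduceAdd] at this
    linear_combination (-1 / 2) * this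
  · simp only [Fin.reduceAdd] at this
    linear_combination (1 / 2) * this

/-- Both pairs of one SWAP differ completely: flips at 0 and 2 agree, as do those at 1 and 3, with
opposite sign. -/
theorem parityProd_zero_one (h : ∀ u v, matchgate u v (projEven 8 (pairTensor a)) = 0)
    {p q s t r z : Fin 2} (hpq : p + q + s + t + r + z = 0) :
    (parityProd (a 0) p * parityProd (a 1) q -
      parityProd (a 0) (p + 1) * parityProd (a 1) (q + 1)) * (a 2 s t * a 3 r z) ^ 2 = 0 := by
  have := h ![p + 1, q, 0, 0, s, r, t, z] ![p, q + 1, 1, 1, s, r, t, z]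
  rw [matchgate_projEven (by clear * - hpq; decide +revert) (by clear * - hpq; decide +revert)]
    at this
  have h2 : ∀ p : Fin 2, p + 1 + 1 = p := by decide
  simp [Fin.sum_univ_eight, Fin.prod_univ_eight, flip, pairTensor, h2] at this
  simp only [parityProd_eq, h2]
  linear_combination (1 / 2) * this

theorem parityProd_two_three (h : ∀ u v, matchgate u v (projEven 8 (pairTensor a)) = 0)
    {p q s t r z : Fin 2} (hpq : p + q + s + t + r + z = 0) :
    (parityProd (a 2) p * parityProd (a 3) q -
      parityProd (a 2) (p + 1) * parityProd (a 3) (q + 1)) * (a 0 s t * a 1 r z) ^ 2 = 0 := by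
  have := h ![s, r, t, z, p + 1, q, 0, 0] ![s, r, t, z, p, q + 1, 1, 1]
  rw [matchgate_projEven (by clear * - hpq; decide +revert) (by clear * - hpq; decide +revert)]
    at this
  have h2 : ∀ p : Fin 2, p + 1 + 1 = p := by decide
  simp [Fin.sum_univ_eight, Fin.prod_univ_eight, flip, pairTensor, h2] at this
  simp only [parityProd_eq, h2]
  linear_combination (1 / 2) * this

/-! ### Vanishing of the even part -/

theorem exists_ne_zero_of_det_ne_zero {m : Matrix (Fin 2) (Fin 2) ℂ} (hd : m.det ≠ 0) :
    ∃ s t, m s t ≠ 0 := by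
  by_contra! h
  exact hd (by simp [Matrix.det_fin_two, h])

theorem colMonomial_of_row {m : Matrix (Fin 2) (Fin 2) ℂ} (hd : m.det ≠ 0)
    (h : ∀ x, m x 0 * m x 1 = 0) : ColMonomial m := by
  have h0 := h 0
  have h1 := h 1
  rw [Matrix.det_fin_two] at hd
  intro y
  -- Times the determinant, a column product is a combination of the two row products.
  apply (mul_eq_zero_iff_left hd).mp
  obtain rfl | rfl : y = 0 ∨ y = 1 := by clear * -; decide +revert
  · linear_combination (m 0 0 * m 0 0) * h1 - (m 1 0 * m 1 0) * h0
  · linear_combination (m 1 1 * m 1 1) * h0 - (m 0 1 * m 0 1) * h1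

theorem forall_or_forall_of_mul {f g : Fin 2 → ℂ} {d e : ℂ} (hd : d ≠ 0) (he : e ≠ 0)
    (h : ∀ y v, d * f y * g v * e ^ 2 = 0) : (∀ y, f y = 0) ∨ ∀ v, g v = 0 := by
  by_contra! hc
  obtain ⟨⟨y, hy⟩, v, hv⟩ := hc
  have := h y v
  simp_all

/-- The even part of a product of four invertible pairings satisfies all matchgate relations only
if it vanishes. -/
theorem projEven_pairTensor_eq_zero (h : ∀ u v, matchgate u v (projEven 8 (pairTensor a)) = 0)
    (hd : ∀ j, (a j).det ≠ 0) : projEven 8 (pairTensor a) = 0 := by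
  obtain ⟨s₂, t₂, h₂⟩ := exists_ne_zero_of_det_ne_zero (hd 2)
  obtain ⟨s₃, t₃, h₃⟩ := exists_ne_zero_of_det_ne_zero (hd 3)
  have h12 : ColMonomial (a 1) ∨ ColMonomial (a 2) :=
    forall_or_forall_of_mul (hd 0) h₃ fun y v => det_mul_one_two h y v s₃ t₃
  have h13 : ColMonomial (a 1) ∨ ColMonomial (a 3) :=
    forall_or_forall_of_mul (hd 0) h₂ fun y v => det_mul_one_three h y v s₂ t₂
  have h02 : ColMonomial (a 0) ∨ ColMonomial (a 2) :=
    (forall_or_forall_of_mul (hd 1) h₃ fun y v => det_mul_zero_two h y v s₃ t₃).imp_left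
      (colMonomial_of_row (hd 0))
  have h03 : ColMonomial (a 0) ∨ ColMonomial (a 3) :=
    (forall_or_forall_of_mul (hd 1) h₂ fun y v => det_mul_zero_three h y v s₂ t₂).imp_left
      (colMonomial_of_row (hd 0))
  funext w
  by_cases hw : Even (weight w)
  swap
  · exact if_neg hw
  by_contra hne
  have hT : pairTensor a w ≠ 0 := by
    intro h0
    apply hne
    change (if Even (weight w) then pairTensor a w else 0) = 0
    rw [if_pos hw, h0]
  have hsum := (even_weight_iff w).mp hw
  rw [Fin.sum_univ_eight] at hsum
  simp only [pairTensor, mul_ne_zero_iff] at hT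
  obtain ⟨⟨⟨e0, e1⟩, e2⟩, e3⟩ := hT
  -- With both factors of a SWAP monomial, a nonzero even coefficient makes the first parity product
  -- of the quadric nonzero and the second zero. If `a 0` or `a 1` is not monomial, the four
  -- alternatives make `a 2` and `a 3` so.
  by_cases h01 : ColMonomial (a 0) ∧ ColMonomial (a 1)
  · have hp := h01.1.parityProd_ne_zero (hd 0) e0
    have hq := h01.2.parityProd_ne_zero (hd 1) e1
    have := parityProd_zero_one h (p := w 0 + w 2) (q := w 1 + w 3) (s := w 4) (t := w 6)
      (r := w 5) (z := w 7) (by rw [← hsum]; abel)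
    have hz := (mul_eq_zero.mp (h01.1.parityProd_mul (w 0 + w 2))).resolve_left hp
    simp_all
  · have h23 : ColMonomial (a 2) ∧ ColMonomial (a 3) := by tauto
    have hp := h23.1.parityProd_ne_zero (hd 2) e2
    have hq := h23.2.parityProd_ne_zero (hd 3) e3
    have := parityProd_two_three h (p := w 4 + w 6) (q := w 5 + w 7) (s := w 0) (t := w 2)
      (r := w 1) (z := w 3) (by rw [← hsum]; abel)
    have hz := (mul_eq_zero.mp (h23.1.parityProd_mul (w 4 + w 6))).resolve_left hp
    simp_all

end PfaffianCogate

end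

theorem mainTheorem4 :
    (PfaffianCogate.projEven 8 ''
        PfaffianCogate.zariskiClosure
          (PfaffianCogate.slOrbit (PfaffianCogate.tensor PfaffianCogate.SWAP PfaffianCogate.SWAP)))
      ∩ (PfaffianCogate.cone 8 \ {0}) = ∅ ∧
    (PfaffianCogate.projEven 8 ''
        PfaffianCogate.glOrbit (PfaffianCogate.tensor PfaffianCogate.SWAP PfaffianCogate.SWAP))
      ∩ PfaffianCogate.puncturedCone 8 = ∅ := by
  constructor <;> rw [Set.eq_empty_iff_forall_notMem]
  · rintro _ ⟨⟨T, hT, rfl⟩, hcone, hne⟩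
    obtain ⟨a, hd, rfl⟩ := PfaffianCogate.zariskiClosure_slOrbit_subset hT
    exact hne (PfaffianCogate.projEven_pairTensor_eq_zero
      (PfaffianCogate.matchgate_cone hcone) hd)
  · rintro _ ⟨⟨T, hT, rfl⟩, hcone⟩
    obtain ⟨a, hd, rfl⟩ := PfaffianCogate.glOrbit_subset hT
    exact PfaffianCogate.ne_zero_of_mem_puncturedCone hcone
      (PfaffianCogate.projEven_pairTensor_eq_zero
        (PfaffianCogate.matchgate_puncturedCone hcone) hd)
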